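/- **Lemma (Spectral gap).** Let $\pi$ be a probability measure on a measurable space $K$. A Markov process on $K$ with invariant measure $\pi$ is given by its (Markov) transition kernels $P_t(x,dy)$, $t\ge 0$, with $P_0(x,\cdot)=\delta_x$, satisfying the Chapman–Kolmogorov equations and leaving $\pi$ invariant; its semigroup on the real Hilbert space $L^2_{\mathbb R}(\pi)$ is $T_tf(x)=\int f(y)\,P_t(x,dy)$, and its generator is the operator $\mathcal L f=\lim_{t\downarrow 0}t^{-1}(T_tf-f)$ (limit in $L^2_{\mathbb R}(\pi)$), defined for all $f$ for which the limit exists. All semigroups are assumed strongly continuous. The spectrum $\sigma(\mathcal L)\subset\mathbb C$ of an operator $\mathcal L$ in $L^2_{\mathbb R}(\pi)$ is the spectrum of its extension $\mathcal L(u+iv)=\mathcal Lu+i\mathcal Lv$ to $L^2_{\mathbb C}(\pi)$, and its spectral gap is $$\lambda(\mathcal L)=\sup\{\operatorname{Re} z : z\in\sigma(\mathcal L),\ z\neq 0\}\in[-\infty,\infty]\qquad(\sup\emptyset=-\infty).$$ Let $\mathcal L_0$, with domain $D(\mathcal L_0)$, be the generator of a Markov process on $K$ with invariant measure $\pi$ that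 is time-reversible (detailed balance: $\int_B P_t(x,C)\,\pi(dx)=\int_C P_t(x,B)\,\pi(dx)$ for all measurable $B,C$ and all $t$) and ergodic (if $f\in L^2_{\mathbb R}(\pi)$ and $T_tf=f$ for all $t$, then $f$ is constant $\pi$-a.e.). Assume that, for some real $\lambda_0<0$, $$\sigma(\mathcal L_0)\setminus\{0\}\subset(-\infty,\lambda_0].$$ Let $\mathcal S$ and $\mathcal A$ be linear operators in $L^2_{\mathbb R}(\pi)$ with domains $D(\mathcal S)\supset D(\mathcal L_0)$ and $D(\mathcal A)\supset D(\mathcal L_0)$ such that * $\langle f,\mathcal S g\rangle=\langle \mathcal S f,g\rangle$ and $\langle f,\mathcal S f\rangle\le 0$ for all $f,g\in D(\mathcal S)$; * $\langle f,\mathcal A g\rangle=-\langle \mathcal A f,g\rangle$ for all $f,g\in D(\mathcal A)$; * $\mathcal L=\mathcal L_0+\mathcal S+\mathcal A$, with domain $D(\mathcal L_0)$, is the generator of a Markov process on $K$ with invariant measure $\pi$. Denote its semigroup by $T_t$. Then 1. $\lambda(\mathcal L)\le\lambda(\mathcal L_0)$; 2. $\sigma(\mathcal L)\setminus\{0\}\subset\{z\in\mathbb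 C:\operatorname{Re} z\le\lambda_0\}$; 3. $\|T_tf\|\le e^{\lambda_0 t}\|f\|$ for all $t\ge 0$ and all $f\in L^2_{\mathbb R}(\pi)$ with $\int f\,d\pi=0$. -/

import Mathlib

open MeasureTheory ProbabilityTheory Filter Topology
open scoped NNReal ENNReal

namespace SpectralGap

noncomputable section

/-- A (time-homogeneous, conservative) Markov process on the state space `K`, given by its
transition kernels `P_t(x, dy)`, together with an invariant probability measure `π`. -/
structure MarkovProcess (K : Type*) [MeasurableSpace K] (π : Measure K) where
  /-- the transition kernels -/
  kernel : ℝ≥0 → Kernel K K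
  isMarkov : ∀ t, IsMarkovKernel (kernel t)
  kernel_zero : kernel 0 = Kernel.id
  /-- the Chapman-Kolmogorov equations -/
  kernel_add : ∀ s t, kernel (s + t) = kernel s ∘ₖ kernel t
  invariant : ∀ t, (kernel t).Invariant π

section KernelOperator

variable {K : Type*} [MeasurableSpace K] {π : Measure K} {κ : Kernel K K}

theorem lintegral_kernel_eq (hπ : κ.Invariant π) {f : K → ℝ≥0∞} (hf : Measurable f) :
    ∫⁻ x, ∫⁻ y, f y ∂(κ x) ∂π = ∫⁻ x, f x ∂π := by
  conv_rhs => rw [← hπ.def]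
  rw [Measure.lintegral_bind κ.aemeasurable hf.aemeasurable]

theorem enorm_integral_sq_le [IsMarkovKernel κ] {f : K → ℝ} (hf : StronglyMeasurable f) (x : K) :
    ‖∫ y, f y ∂(κ x)‖ₑ ^ (2 : ℝ) ≤ ∫⁻ y, ‖f y‖ₑ ^ (2 : ℝ) ∂(κ x) := by
  have h1 : ‖∫ y, f y ∂(κ x)‖ₑ ≤ eLpNorm f 1 (κ x) := by
    rw [eLpNorm_one_eq_lintegral_enorm]
    exact enorm_integral_le_lintegral_enorm f
  have h2 : eLpNorm f 1 (κ x) ≤ eLpNorm f 2 (κ x) :=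
    eLpNorm_le_eLpNorm_of_exponent_le (by norm_num) hf.aestronglyMeasurable
  have h3 : eLpNorm f 2 (κ x) ^ (2 : ℝ) = ∫⁻ y, ‖f y‖ₑ ^ (2 : ℝ) ∂(κ x) := by
    have := eLpNorm_nnreal_pow_eq_lintegral (f := f) (μ := κ x) (p := 2) (by norm_num)
    simpa using this
  rw [← h3]
  exact ENNReal.rpow_le_rpow (h1.trans h2) (by norm_num)

theorem eLpNorm_kernel_le [IsMarkovKernel κ] (hπ : κ.Invariant π) {f : K → ℝ}
    (hf : StronglyMeasurable f) :
    eLpNorm (fun x => ∫ y, f y ∂(κ x)) 2 π ≤ eLpNorm f 2 π := by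
  have h1 := eLpNorm_nnreal_pow_eq_lintegral (f := f) (μ := π) (p := 2) (by norm_num)
  have h2 := eLpNorm_nnreal_pow_eq_lintegral (f := fun x => ∫ y, f y ∂(κ x)) (μ := π) (p := 2)
    (by norm_num)
  have h3 : ∫⁻ x, ‖∫ y, f y ∂(κ x)‖ₑ ^ (2 : ℝ) ∂π ≤ ∫⁻ x, ‖f x‖ₑ ^ (2 : ℝ) ∂π := by
    rw [← lintegral_kernel_eq hπ (hf.enorm.pow_const (2 : ℝ))]
    exact lintegral_mono fun x => enorm_integral_sq_le hf x
  refine (ENNReal.rpow_le_rpow_iff (z := 2) (by norm_num)).1 ?_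
  simpa using (h2.trans_le (by simpa using h3)).trans_eq (by simpa using h1.symm)

theorem memLp_kernel [IsMarkovKernel κ] (hπ : κ.Invariant π) (f : Lp ℝ 2 π) :
    MemLp (fun x => ∫ y, f y ∂(κ x)) 2 π :=
  ⟨((Lp.stronglyMeasurable f).integral_kernel).aestronglyMeasurable,
    (eLpNorm_kernel_le hπ (Lp.stronglyMeasurable f)).trans_lt (Lp.memLp f).2⟩

theorem ae_ae_of_invariant (hπ : κ.Invariant π) {p : K → Prop} (hp : ∀ᵐ x ∂π, p x) :
    ∀ᵐ x ∂π, ∀ᵐ y ∂(κ x), p y := by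
  rw [← hπ.def] at hp
  exact Measure.ae_ae_of_ae_bind κ.aemeasurable hp

theorem ae_integrable_kernel [IsProbabilityMeasure π] [IsMarkovKernel κ] (hπ : κ.Invariant π)
    (f : Lp ℝ 2 π) : ∀ᵐ x ∂π, Integrable f (κ x) := by
  have hf := Lp.stronglyMeasurable f
  have hint : Integrable f π := (Lp.memLp f).integrable (by norm_num)
  have h : ∫⁻ x, ∫⁻ y, ‖f y‖ₑ ∂(κ x) ∂π ≠ ∞ := by
    rw [lintegral_kernel_eq hπ hf.enorm]
    exact hint.2.ne
  filter_upwards [ae_lt_top (hf.enorm.lintegral_kernel) h] with x hx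
  exact ⟨hf.aestronglyMeasurable, hx⟩

/-- The operator `f ↦ ∫ f(y) κ(·, dy)` on the real Hilbert space `L²(π)`, for a Markov kernel `κ`
that leaves `π` invariant. -/
def kernelOp (π : Measure K) [IsProbabilityMeasure π] (κ : Kernel K K) [IsMarkovKernel κ]
    (hπ : κ.Invariant π) : Lp ℝ 2 π →L[ℝ] Lp ℝ 2 π :=
  LinearMap.mkContinuous
    { toFun := fun f => (memLp_kernel hπ f).toLp _
      map_add' := by
        intro f g
        rw [← MemLp.toLp_add]
        refine MemLp.toLp_congr _ _ ?_
        filter_upwards [ae_ae_of_invariant hπ (Lp.coeFn_add f g), ae_integrable_kernel hπ f,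
          ae_integrable_kernel hπ g] with x hx hf hg
        rw [integral_congr_ae hx]
        exact integral_add hf hg
      map_smul' := by
        intro c f
        rw [RingHom.id_apply, ← MemLp.toLp_const_smul]
        refine MemLp.toLp_congr _ _ ?_
        filter_upwards [ae_ae_of_invariant hπ (Lp.coeFn_smul c f)] with x hx
        rw [integral_congr_ae hx]
        exact integral_const_mul c _ }
    1 (by
      intro f
      rw [one_mul]
      change ‖(memLp_kernel hπ f).toLp _‖ ≤ ‖f‖
      rw [Lp.norm_toLp, Lp.norm_def]
      exact ENNReal.toReal_mono (Lp.memLp f).2.ne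
        (eLpNorm_kernel_le hπ (Lp.stronglyMeasurable f)))

theorem kernelOp_ae_eq [IsProbabilityMeasure π] [IsMarkovKernel κ] (hπ : κ.Invariant π)
    (f : Lp ℝ 2 π) : kernelOp π κ hπ f =ᵐ[π] fun x => ∫ y, f y ∂(κ x) :=
  (memLp_kernel hπ f).coeFn_toLp

end KernelOperator

namespace MarkovProcess

variable {K : Type*} [MeasurableSpace K] {π : Measure K} [IsProbabilityMeasure π]

/-- The Markov semigroup `(T_t f)(x) = ∫ f(y) P_t(x, dy)` on the real Hilbert space `L²(π)`. -/
def semigroup (X : MarkovProcess K π) (t : ℝ≥0) : Lp ℝ 2 π →L[ℝ] Lp ℝ 2 π :=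
  haveI := X.isMarkov t
  kernelOp π (X.kernel t) (X.invariant t)

/-- Strong continuity of the semigroup of `X` on `L²(π)`. -/
def StronglyContinuous (X : MarkovProcess K π) : Prop :=
  ∀ f : Lp ℝ 2 π, Continuous fun t => X.semigroup t f

/-- Time reversibility with respect to `π` (detailed balance for all the transition kernels). -/
def Reversible (X : MarkovProcess K π) : Prop :=
  ∀ t, (X.kernel t).IsReversible π

/-- Ergodicity with respect to `π`: every `f ∈ L²(π)` that is invariant under the semigroup is
constant `π`-almost everywhere. -/
def Ergodic (X : MarkovProcess K π) : Prop :=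
  ∀ f : Lp ℝ 2 π, (∀ t, X.semigroup t f = f) → ∃ c : ℝ, f =ᵐ[π] fun _ => c

/-- `L` is the infinitesimal generator of the semigroup of `X` on `L²(π)`: the pairs `(f, L f)`,
with `f` in the domain of `L`, are exactly the pairs `(f, g)` with `t⁻¹ (T_t f - f) → g` in
`L²(π)` as `t ↓ 0`. -/
def IsGenerator (X : MarkovProcess K π) (L : Lp ℝ 2 π →ₗ.[ℝ] Lp ℝ 2 π) : Prop :=
  ∀ f g : Lp ℝ 2 π, (f, g) ∈ L.graph ↔
    Tendsto (fun t : ℝ≥0 => (t : ℝ)⁻¹ • (X.semigroup t f - f)) (𝓝[>] 0) (𝓝 g)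

end MarkovProcess

section Spectrum

variable {K : Type*} [MeasurableSpace K] {π : Measure K}

/-- Real part, from complex to real `L²(π)`. -/
def reL2 (π : Measure K) : Lp ℂ 2 π →L[ℝ] Lp ℝ 2 π := Complex.reCLM.compLpL 2 π

/-- Imaginary part, from complex to real `L²(π)`. -/
def imL2 (π : Measure K) : Lp ℂ 2 π →L[ℝ] Lp ℝ 2 π := Complex.imCLM.compLpL 2 π

/-- The inclusion of real into complex `L²(π)`. -/
def ofRealL2 (π : Measure K) : Lp ℝ 2 π →L[ℝ] Lp ℂ 2 π := Complex.ofRealCLM.compLpL 2 π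

theorem reL2_smul (c : ℂ) (f : Lp ℂ 2 π) :
    reL2 π (c • f) = c.re • reL2 π f - c.im • imL2 π f := by
  apply Lp.ext
  filter_upwards [Complex.reCLM.coeFn_compLpL (p := 2) (μ := π) (c • f),
    Complex.reCLM.coeFn_compLpL (p := 2) (μ := π) f,
    Complex.imCLM.coeFn_compLpL (p := 2) (μ := π) f, Lp.coeFn_smul c f,
    Lp.coeFn_sub (c.re • reL2 π f) (c.im • imL2 π f), Lp.coeFn_smul c.re (reL2 π f),
    Lp.coeFn_smul c.im (imL2 π f)] with x h1 h2 h3 h4 h5 h6 h7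
  rw [h5, Pi.sub_apply, h6, h7]
  simp only [Pi.smul_apply, reL2, imL2]
  rw [h1, h2, h3, h4]
  simp

theorem imL2_smul (c : ℂ) (f : Lp ℂ 2 π) :
    imL2 π (c • f) = c.re • imL2 π f + c.im • reL2 π f := by
  apply Lp.ext
  filter_upwards [Complex.imCLM.coeFn_compLpL (p := 2) (μ := π) (c • f),
    Complex.reCLM.coeFn_compLpL (p := 2) (μ := π) f,
    Complex.imCLM.coeFn_compLpL (p := 2) (μ := π) f, Lp.coeFn_smul c f,
    Lp.coeFn_add (c.re • imL2 π f) (c.im • reL2 π f), Lp.coeFn_smul c.im (reL2 π f),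
    Lp.coeFn_smul c.re (imL2 π f)] with x h1 h2 h3 h4 h5 h6 h7
  rw [h5, Pi.add_apply, h6, h7]
  simp only [Pi.smul_apply, reL2, imL2]
  rw [h1, h2, h3, h4]
  simp

theorem ofRealL2_smul (r : ℝ) (f : Lp ℝ 2 π) :
    ofRealL2 π (r • f) = (r : ℂ) • ofRealL2 π f := by
  rw [map_smul]
  apply Lp.ext
  filter_upwards [Lp.coeFn_smul r (ofRealL2 π f), Lp.coeFn_smul (r : ℂ) (ofRealL2 π f)]
    with x h1 h2
  rw [h1, h2]
  simp

/-- The `f = u + i v` with `u` and `v` in the domain of the real operator `B`. -/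
def complexDomain (B : Lp ℝ 2 π →ₗ.[ℝ] Lp ℝ 2 π) : Submodule ℂ (Lp ℂ 2 π) where
  carrier := {f | reL2 π f ∈ B.domain ∧ imL2 π f ∈ B.domain}
  zero_mem' := ⟨by rw [map_zero]; exact B.domain.zero_mem, by rw [map_zero]; exact B.domain.zero_mem⟩
  add_mem' := by
    rintro f g ⟨hf, hf'⟩ ⟨hg, hg'⟩
    refine ⟨?_, ?_⟩
    · rw [map_add]
      exact B.domain.add_mem hf hg
    · rw [map_add]
      exact B.domain.add_mem hf' hg'
  smul_mem' := by
    rintro c f ⟨hf, hf'⟩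
    refine ⟨?_, ?_⟩
    · rw [reL2_smul]
      exact B.domain.sub_mem (B.domain.smul_mem _ hf) (B.domain.smul_mem _ hf')
    · rw [imL2_smul]
      exact B.domain.add_mem (B.domain.smul_mem _ hf') (B.domain.smul_mem _ hf)

/-- `B (u + i v) = B u + i B v` for `u` and `v` in the domain of the real operator `B`. -/
def complexFun (B : Lp ℝ 2 π →ₗ.[ℝ] Lp ℝ 2 π) (f : complexDomain B) : Lp ℂ 2 π :=
  ofRealL2 π (B ⟨reL2 π f, f.2.1⟩) + Complex.I • ofRealL2 π (B ⟨imL2 π f, f.2.2⟩)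

theorem complexFun_add (B : Lp ℝ 2 π →ₗ.[ℝ] Lp ℝ 2 π) (f g : complexDomain B) :
    complexFun B (f + g) = complexFun B f + complexFun B g := by
  have h1 : (⟨reL2 π (f + g : complexDomain B), (f + g).2.1⟩ : B.domain)
      = ⟨reL2 π f, f.2.1⟩ + ⟨reL2 π g, g.2.1⟩ :=
    Subtype.ext (map_add (reL2 π) (f : Lp ℂ 2 π) (g : Lp ℂ 2 π))
  have h2 : (⟨imL2 π (f + g : complexDomain B), (f + g).2.2⟩ : B.domain)
      = ⟨imL2 π f, f.2.2⟩ + ⟨imL2 π g, g.2.2⟩ :=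
    Subtype.ext (map_add (imL2 π) (f : Lp ℂ 2 π) (g : Lp ℂ 2 π))
  unfold complexFun
  rw [h1, h2, B.map_add, B.map_add, map_add, map_add, smul_add]
  abel

theorem complexFun_smul (B : Lp ℝ 2 π →ₗ.[ℝ] Lp ℝ 2 π) (c : ℂ) (f : complexDomain B) :
    complexFun B (c • f) = c • complexFun B f := by
  have h1 : (⟨reL2 π (c • f : complexDomain B), (c • f).2.1⟩ : B.domain)
      = c.re • ⟨reL2 π f, f.2.1⟩ - c.im • ⟨imL2 π f, f.2.2⟩ :=
    Subtype.ext (reL2_smul c (f : Lp ℂ 2 π))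
  have h2 : (⟨imL2 π (c • f : complexDomain B), (c • f).2.2⟩ : B.domain)
      = c.re • ⟨imL2 π f, f.2.2⟩ + c.im • ⟨reL2 π f, f.2.1⟩ :=
    Subtype.ext (imL2_smul c (f : Lp ℂ 2 π))
  unfold complexFun
  rw [h1, h2, B.map_sub, B.map_add, B.map_smul, B.map_smul, B.map_smul, B.map_smul,
    map_sub, map_add, ofRealL2_smul, ofRealL2_smul, ofRealL2_smul, ofRealL2_smul]
  generalize ofRealL2 π (B ⟨reL2 π f, f.2.1⟩) = u
  generalize ofRealL2 π (B ⟨imL2 π f, f.2.2⟩) = v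
  have hc : c • (u + Complex.I • v)
      = ((c.re : ℂ) + c.im * Complex.I) • (u + Complex.I • v) := by rw [Complex.re_add_im]
  have hI : ((c.im : ℂ) * Complex.I) • Complex.I • v = -((c.im : ℂ) • v) := by
    rw [smul_smul, mul_assoc, Complex.I_mul_I, mul_neg, mul_one, neg_smul]
  rw [hc, add_smul, smul_add, smul_add, smul_add, hI, smul_comm Complex.I (c.re : ℂ) v,
    mul_smul, smul_comm Complex.I (c.im : ℂ) u]
  abel

/-- The extension of a real operator `B` in real `L²(π)` to complex `L²(π)`. -/
def complexify (B : Lp ℝ 2 π →ₗ.[ℝ] Lp ℝ 2 π) : Lp ℂ 2 π →ₗ.[ℂ] Lp ℂ 2 π where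
  domain := complexDomain B
  toFun :=
    { toFun := complexFun B
      map_add' := complexFun_add B
      map_smul' := complexFun_smul B }

/-- The spectrum of a (possibly unbounded) operator `L` in a complex normed space: the `z` for
which `z - L`, from the domain of `L` to the whole space, has no bounded two-sided inverse. -/
def opSpectrum {H : Type*} [NormedAddCommGroup H] [NormedSpace ℂ H] (L : H →ₗ.[ℂ] H) : Set ℂ :=
  {z | ¬ ∃ R : H →L[ℂ] H,
    (∀ g : H, ∃ f : L.domain, (f : H) = R g ∧ z • (f : H) - L f = g) ∧
    ∀ f : L.domain, R (z • (f : H) - L f) = f}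

/-- The spectrum `σ(L)`, in complex `L²(π)`, of a real operator `L` in real `L²(π)`. -/
def specL2 (L : Lp ℝ 2 π →ₗ.[ℝ] Lp ℝ 2 π) : Set ℂ := opSpectrum (complexify L)

/-- The spectral gap `sup {Re z : z ∈ σ(L), z ≠ 0}`, with `sup ∅ = -∞`. -/
def spectralGap (L : Lp ℝ 2 π →ₗ.[ℝ] Lp ℝ 2 π) : EReal :=
  ⨆ z ∈ specL2 L \ {0}, ((z.re : ℝ) : EReal)

end Spectrum

end

end SpectralGap

/-!
The perturbations act on the quadratic form in one direction only: for `f` in the domain,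
`⟪f, L f⟫ = ⟪f, L₀ f⟫ + ⟪f, S f⟫ + ⟪f, A f⟫ ≤ ⟪f, L₀ f⟫`, because `S` is nonpositive and `A` is
antisymmetric. So everything follows from the Poincaré inequality `⟪f, L₀ f⟫ ≤ lam ‖f‖²` for
mean-zero `f` in the domain of `L₀`, and from the passage back from a form bound to the semigroup
and to the spectrum of the operator `L`, which need not be normal.

*Poincaré inequality* (`inner_generator_le`). The generator of a reversible process is symmetric.
The gap hypothesis puts `1` in its resolvent set, so `R = (1 - L₀)⁻¹` is a bounded self-adjoint
operator; it exists by hypothesis, and no generation theorem is needed. The hypothesis also gives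
`σ(R) ⊆ [0, a] ∪ {1}` with `a = (1 - lam)⁻¹` (`IsResolvent.isUnit_sub`). The polynomial
`x (a - x) (1 - x)²` is nonnegative on this set, so the functional calculus gives `R² ≤ a R` on the
closure of the range of `1 - R` (`norm_sq_le_of_spectrum_subset`), which is the orthogonal
complement of the fixed vectors of `R`; by ergodicity these are the constants. With `f = R w` and
`w = f - L₀ f`, the bound `‖R w‖² ≤ a ⟪R w, w⟫` is the Poincaré inequality.

*Decay* (`norm_semigroup_le`). Along an orbit of `T_t` in the domain of `L`, the right derivative of
`‖T_t f‖²` is `2 ⟪T_t f, L T_t f⟫ ≤ 2 lam ‖T_t f‖²`, and Grönwall's inequality gives the decay. The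
domain of `L` is that of `L₀`, which is dense since `R` is self-adjoint and injective
(`dense_domain`).

*Spectrum* (`exists_resolvent_of_decay`). For `z ≠ 0` and `lam < Re z`, the inverse of `z - L` is
`∫₀^∞ exp (-z t) T_t dt` on mean-zero functions and `z⁻¹` on constants.

Finally, these conclusions hold at every `lam < 0` that bounds `σ(L₀) \ {0}` from above, and
letting `lam` decrease to the spectral gap of `L₀`, which may be `-∞`, compares the two gaps.
-/

namespace SpectralGap

noncomputable section

/-! ### Markov semigroups on real `L²` -/

section KernelOperatorFacts

variable {K : Type*} [MeasurableSpace K] {π : Measure K} [IsProbabilityMeasure π]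
  {κ : Kernel K K} [IsMarkovKernel κ]

/-- The mean value `f ↦ ∫ f dπ`, as an operator on real `L²(π)` with values in the constants. It is
the orthogonal projection onto the constants. -/
def meanOp (π : Measure K) [IsProbabilityMeasure π] : Lp ℝ 2 π →L[ℝ] Lp ℝ 2 π :=
  (innerSL ℝ (Lp.const 2 π (1 : ℝ))).smulRight (Lp.const 2 π (1 : ℝ))

theorem inner_const_one (f : Lp ℝ 2 π) : inner ℝ (Lp.const 2 π (1 : ℝ)) f = ∫ x, f x ∂π := by
  rw [L2.inner_def]
  refine integral_congr_ae ?_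
  filter_upwards [Lp.coeFn_const (p := 2) (μ := π) (1 : ℝ)] with x hx
  rw [hx]
  simp

theorem meanOp_apply (f : Lp ℝ 2 π) :
    meanOp π f = (∫ x, f x ∂π) • Lp.const 2 π (1 : ℝ) := by
  rw [← inner_const_one]
  rfl

theorem integral_const_one : ∫ x, (Lp.const 2 π (1 : ℝ) : Lp ℝ 2 π) x ∂π = 1 := by
  rw [integral_congr_ae (Lp.coeFn_const (p := 2) (μ := π) (1 : ℝ))]
  simp

theorem meanOp_const_one : meanOp π (Lp.const 2 π (1 : ℝ)) = Lp.const 2 π (1 : ℝ) := by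
  rw [meanOp_apply, integral_const_one, one_smul]

theorem meanOp_meanOp (f : Lp ℝ 2 π) : meanOp π (meanOp π f) = meanOp π f := by
  conv_lhs => rw [meanOp_apply f, map_smul, meanOp_const_one, ← meanOp_apply]

theorem inner_meanOp_right (f g : Lp ℝ 2 π) :
    inner ℝ f (meanOp π g) = (∫ x, f x ∂π) * ∫ x, g x ∂π := by
  rw [meanOp_apply, inner_smul_right, real_inner_comm, inner_const_one, mul_comm]

theorem integrable_coeFn (f : Lp ℝ 2 π) : Integrable f π :=
  (Lp.memLp f).integrable (by norm_num)

theorem kernelOp_const_one (hπ : κ.Invariant π) :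
    kernelOp π κ hπ (Lp.const 2 π (1 : ℝ)) = Lp.const 2 π (1 : ℝ) := by
  have h1 := Lp.coeFn_const (p := 2) (μ := π) (1 : ℝ)
  apply Lp.ext
  filter_upwards [kernelOp_ae_eq hπ (Lp.const 2 π (1 : ℝ)), ae_ae_of_invariant hπ h1, h1]
    with x h2 h3 h4
  rw [h2, h4, integral_congr_ae h3]
  simp

theorem integral_kernelOp (hπ : κ.Invariant π) (f : Lp ℝ 2 π) :
    ∫ x, kernelOp π κ hπ f x ∂π = ∫ x, f x ∂π := by
  rw [integral_congr_ae (kernelOp_ae_eq hπ f)]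
  have hc : (κ ∘ₖ Kernel.const Unit π) () = π := by
    rw [Kernel.comp_apply, Kernel.const_apply, hπ.def]
  have h := Kernel.integral_comp (η := κ) (κ := Kernel.const Unit π) (a := ()) (f := f)
    (by rw [hc]; exact integrable_coeFn f)
  rw [hc, Kernel.const_apply] at h
  exact h.symm

theorem kernelOp_comp {η : Kernel K K} [IsMarkovKernel η] (hκ : κ.Invariant π)
    (hη : η.Invariant π) (hc : (κ ∘ₖ η).Invariant π) (f : Lp ℝ 2 π) :
    kernelOp π (κ ∘ₖ η) hc f = kernelOp π η hη (kernelOp π κ hκ f) := by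
  apply Lp.ext
  filter_upwards [kernelOp_ae_eq hc f, kernelOp_ae_eq hη (kernelOp π κ hκ f),
    ae_ae_of_invariant hη (kernelOp_ae_eq hκ f), ae_integrable_kernel hc f] with x h1 h2 h3 h4
  rw [h1, h2, integral_congr_ae h3, Kernel.integral_comp h4]

/-- Under detailed balance, the joint law of a stationary pair is exchangeable. -/
theorem map_swap_compProd (hr : κ.IsReversible π) : (π ⊗ₘ κ).map Prod.swap = π ⊗ₘ κ := by
  refine (Measure.ext_prod fun {s t} hs ht => ?_)
  rw [Measure.map_apply measurable_swap (hs.prod ht), Set.preimage_swap_prod,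
    Measure.compProd_apply_prod ht hs, Measure.compProd_apply_prod hs ht]
  exact hr ht hs

theorem integrable_compProd_mul (hπ : κ.Invariant π) (f g : Lp ℝ 2 π) :
    Integrable (fun p : K × K => f p.1 * g p.2) (π ⊗ₘ κ) := by
  have h1 : MemLp (fun p : K × K => f p.1) 2 (π ⊗ₘ κ) := by
    exact (Lp.memLp f).comp_measurePreserving ⟨measurable_fst, Measure.fst_compProd π κ⟩
  have h2 : MemLp (fun p : K × K => g p.2) 2 (π ⊗ₘ κ) := by
    exact (Lp.memLp g).comp_measurePreserving
      ⟨measurable_snd, (Measure.snd_compProd π κ).trans hπ.def⟩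
  exact h1.integrable_mul h2

theorem inner_kernelOp_right (hπ : κ.Invariant π) (f g : Lp ℝ 2 π) :
    inner ℝ f (kernelOp π κ hπ g) = ∫ p : K × K, f p.1 * g p.2 ∂(π ⊗ₘ κ) := by
  rw [Measure.integral_compProd (integrable_compProd_mul hπ f g), L2.inner_def]
  refine integral_congr_ae ?_
  filter_upwards [kernelOp_ae_eq hπ g] with x hx
  rw [hx, integral_const_mul, RCLike.inner_apply, conj_trivial, mul_comm]

theorem inner_kernelOp_comm (hπ : κ.Invariant π) (hr : κ.IsReversible π) (f g : Lp ℝ 2 π) :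
    inner ℝ f (kernelOp π κ hπ g) = inner ℝ (kernelOp π κ hπ f) g := by
  rw [real_inner_comm g, inner_kernelOp_right, inner_kernelOp_right]
  conv_lhs => rw [← map_swap_compProd hr]
  rw [integral_map measurable_swap.aemeasurable]
  · exact integral_congr_ae (Eventually.of_forall fun p => mul_comm _ _)
  · rw [map_swap_compProd hr]
    exact (integrable_compProd_mul hπ f g).1

end KernelOperatorFacts

theorem tendsto_toNNReal_sub (t : ℝ) :
    Tendsto (fun s : ℝ => (s - t).toNNReal) (𝓝[>] t) (𝓝[>] 0) := by
  refine tendsto_nhdsWithin_iff.2 ⟨?_, ?_⟩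
  · have h : Continuous fun s : ℝ => (s - t).toNNReal := by fun_prop
    simpa using (h.tendsto t).mono_left nhdsWithin_le_nhds
  · filter_upwards [self_mem_nhdsWithin] with s hs
    exact Real.toNNReal_pos.2 (sub_pos.2 hs)

namespace MarkovProcess

variable {K : Type*} [MeasurableSpace K] {π : Measure K} [IsProbabilityMeasure π]
  (X : MarkovProcess K π)

theorem semigroup_zero (f : Lp ℝ 2 π) : X.semigroup 0 f = f := by
  have := X.isMarkov 0
  apply Lp.ext
  filter_upwards [kernelOp_ae_eq (X.invariant 0) f] with x hx
  change kernelOp π _ _ f x = f x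
  rw [hx, X.kernel_zero, Kernel.id_apply, integral_dirac' _ _ (Lp.stronglyMeasurable f)]

theorem semigroup_add (s t : ℝ≥0) (f : Lp ℝ 2 π) :
    X.semigroup (s + t) f = X.semigroup s (X.semigroup t f) := by
  have := X.isMarkov s
  have := X.isMarkov t
  have := X.isMarkov (s + t)
  apply Lp.ext
  have hk : X.kernel (s + t) = X.kernel t ∘ₖ X.kernel s := by rw [add_comm, X.kernel_add]
  have hc : (X.kernel t ∘ₖ X.kernel s).Invariant π := hk ▸ X.invariant (s + t)
  have h : X.semigroup s (X.semigroup t f) = kernelOp π (X.kernel t ∘ₖ X.kernel s) hc f :=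
    (kernelOp_comp (X.invariant t) (X.invariant s) hc f).symm
  rw [h]
  filter_upwards [kernelOp_ae_eq (X.invariant (s + t)) f, kernelOp_ae_eq hc f] with x h1 h2
  rw [h2, ← hk]
  exact h1

theorem semigroup_comm (s t : ℝ≥0) (f : Lp ℝ 2 π) :
    X.semigroup s (X.semigroup t f) = X.semigroup t (X.semigroup s f) := by
  rw [← semigroup_add, add_comm, semigroup_add]

theorem semigroup_const_one (t : ℝ≥0) :
    X.semigroup t (Lp.const 2 π (1 : ℝ)) = Lp.const 2 π (1 : ℝ) :=
  haveI := X.isMarkov t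
  kernelOp_const_one (X.invariant t)

theorem integral_semigroup (t : ℝ≥0) (f : Lp ℝ 2 π) :
    ∫ x, X.semigroup t f x ∂π = ∫ x, f x ∂π :=
  haveI := X.isMarkov t
  integral_kernelOp (X.invariant t) f

theorem meanOp_semigroup (t : ℝ≥0) (f : Lp ℝ 2 π) :
    meanOp π (X.semigroup t f) = meanOp π f := by
  rw [meanOp_apply, meanOp_apply, integral_semigroup]

theorem semigroup_meanOp (t : ℝ≥0) (f : Lp ℝ 2 π) :
    X.semigroup t (meanOp π f) = meanOp π f := by
  rw [meanOp_apply, map_smul, semigroup_const_one]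

variable {X}

theorem Reversible.inner_semigroup_comm (hr : X.Reversible) (t : ℝ≥0) (f g : Lp ℝ 2 π) :
    inner ℝ f (X.semigroup t g) = inner ℝ (X.semigroup t f) g :=
  haveI := X.isMarkov t
  inner_kernelOp_comm (X.invariant t) (hr t) f g

/-! ### The generator -/

namespace IsGenerator

variable {L : Lp ℝ 2 π →ₗ.[ℝ] Lp ℝ 2 π}

theorem tendsto (hL : X.IsGenerator L) (f : L.domain) :
    Tendsto (fun t : ℝ≥0 => (t : ℝ)⁻¹ • (X.semigroup t f - f)) (𝓝[>] 0) (𝓝 (L f)) :=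
  (hL f (L f)).1 (L.mem_graph f)

theorem exists_of_tendsto (hL : X.IsGenerator L) {f g : Lp ℝ 2 π}
    (h : Tendsto (fun t : ℝ≥0 => (t : ℝ)⁻¹ • (X.semigroup t f - f)) (𝓝[>] 0) (𝓝 g)) :
    ∃ hf : f ∈ L.domain, L ⟨f, hf⟩ = g := by
  obtain ⟨y, hy, hy'⟩ := L.mem_graph_iff.1 ((hL f g).2 h)
  obtain ⟨y, hyd⟩ := y
  dsimp only at hy hy'
  subst hy
  exact ⟨hyd, hy'⟩

/-- The domain of the generator contains the constants, and the generator vanishes on them. -/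
theorem meanOp_mem (hL : X.IsGenerator L) (f : Lp ℝ 2 π) :
    ∃ hf : meanOp π f ∈ L.domain, L ⟨meanOp π f, hf⟩ = 0 := by
  refine hL.exists_of_tendsto ?_
  simp only [semigroup_meanOp, sub_self, smul_zero]
  exact tendsto_const_nhds

/-- The image of a generator consists of functions of mean zero, by invariance of `π`. -/
theorem meanOp_apply_eq_zero (hL : X.IsGenerator L) (f : L.domain) : meanOp π (L f) = 0 := by
  have h := ((meanOp π).continuous.tendsto _).comp (hL.tendsto f)
  refine tendsto_nhds_unique h ?_
  have : (meanOp π ∘ fun t : ℝ≥0 => (t : ℝ)⁻¹ • (X.semigroup t f - f)) = fun _ => 0 := by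
    funext t
    simp only [Function.comp_apply, map_smul, map_sub, meanOp_semigroup, sub_self, smul_zero]
  rw [this]
  exact tendsto_const_nhds

theorem semigroup_mem (hL : X.IsGenerator L) (t : ℝ≥0) (f : L.domain) :
    ∃ hf : X.semigroup t f ∈ L.domain, L ⟨X.semigroup t f, hf⟩ = X.semigroup t (L f) := by
  refine hL.exists_of_tendsto ?_
  have h := ((X.semigroup t).continuous.tendsto _).comp (hL.tendsto f)
  refine h.congr fun s => ?_
  simp only [Function.comp_apply, map_smul, map_sub]
  rw [semigroup_comm]

theorem symmetric (hL : X.IsGenerator L) (hr : X.Reversible) (f g : L.domain) :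
    inner ℝ (f : Lp ℝ 2 π) (L g) = inner ℝ (L f) (g : Lp ℝ 2 π) := by
  have h1 := (tendsto_const_nhds (x := (f : Lp ℝ 2 π))).inner (𝕜 := ℝ) (hL.tendsto g)
  have h2 := (hL.tendsto f).inner (𝕜 := ℝ) (tendsto_const_nhds (x := (g : Lp ℝ 2 π)))
  refine tendsto_nhds_unique h1 (h2.congr fun t => ?_)
  rw [inner_smul_left, inner_smul_right, inner_sub_left, inner_sub_right,
    hr.inner_semigroup_comm]
  rfl

/-- Orbits starting in the domain of the generator are right differentiable. -/
theorem hasDerivWithinAt (hL : X.IsGenerator L) (f : L.domain) {t : ℝ} (ht : 0 ≤ t) :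
    HasDerivWithinAt (fun s : ℝ => X.semigroup s.toNNReal f) (X.semigroup t.toNNReal (L f))
      (Set.Ici t) t := by
  obtain ⟨hm, he⟩ := hL.semigroup_mem t.toNNReal f
  have h := hL.tendsto ⟨_, hm⟩
  rw [he] at h
  rw [← hasDerivWithinAt_Ioi_iff_Ici, hasDerivWithinAt_iff_tendsto_slope' (by simp)]
  refine (h.comp (tendsto_toNNReal_sub t)).congr' ?_
  filter_upwards [self_mem_nhdsWithin] with s (hs : t < s)
  have hs' : 0 ≤ s - t := sub_nonneg.2 hs.le
  have hst : s.toNNReal = (s - t).toNNReal + t.toNNReal := by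
    rw [← Real.toNNReal_add hs' ht, sub_add_cancel]
  rw [Function.comp_apply, slope_def_module, hst, semigroup_add, Real.coe_toNNReal _ hs']

/-- An element of the kernel of the generator is invariant under the semigroup. -/
theorem semigroup_eq_self (hL : X.IsGenerator L) (hc : X.StronglyContinuous) (f : L.domain)
    (hf : L f = 0) (t : ℝ≥0) : X.semigroup t f = f := by
  have h := constant_of_has_deriv_right_zero (f := fun s : ℝ => X.semigroup s.toNNReal f)
    (a := 0) (b := t) ((hc f).comp continuous_real_toNNReal).continuousOn
    (fun s hs => by
      have := hL.hasDerivWithinAt f hs.1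
      rwa [hf, map_zero] at this) t ⟨t.2, le_rfl⟩
  simpa [semigroup_zero] using h

end IsGenerator

end MarkovProcess

/-! ### Exponential decay from dissipativity -/

section Decay

variable {K : Type*} [MeasurableSpace K] {π : Measure K} [IsProbabilityMeasure π]
  {X : MarkovProcess K π} {L : Lp ℝ 2 π →ₗ.[ℝ] Lp ℝ 2 π} {lam : ℝ}

/-- Decay on the domain: Grönwall's inequality for the squared norm along an orbit, whose right
derivative is `2 ⟪T_t f, L T_t f⟫`. -/
theorem norm_semigroup_le_of_mem_domain (hc : X.StronglyContinuous) (hL : X.IsGenerator L)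
    (hdiss : ∀ f : L.domain, meanOp π f = 0 →
      inner ℝ (f : Lp ℝ 2 π) (L f) ≤ lam * ‖(f : Lp ℝ 2 π)‖ ^ 2)
    (f : L.domain) (hf : meanOp π f = 0) (t : ℝ≥0) :
    ‖X.semigroup t f‖ ≤ Real.exp (lam * t) * ‖(f : Lp ℝ 2 π)‖ := by
  set u : ℝ → Lp ℝ 2 π := fun s => X.semigroup s.toNNReal f with hu
  have hcont : Continuous u := (hc f).comp continuous_real_toNNReal
  have hd : ∀ s ∈ Set.Ico (0 : ℝ) t, HasDerivWithinAt (fun s => ‖u s‖ ^ 2)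
      (2 * inner ℝ (u s) (X.semigroup s.toNNReal (L f))) (Set.Ici s) s :=
    fun s hs => (hL.hasDerivWithinAt f hs.1).norm_sq
  have h := le_gronwallBound_of_liminf_deriv_right_le (f := fun s => ‖u s‖ ^ 2)
    (f' := fun s => 2 * inner ℝ (u s) (X.semigroup s.toNNReal (L f)))
    (δ := ‖(f : Lp ℝ 2 π)‖ ^ 2) (K := 2 * lam) (ε := 0) (a := 0) (b := t)
    (hcont.norm.pow 2).continuousOn
    (fun s hs r hr => (hd s hs).liminf_right_slope_le hr)
    (by simp [hu, X.semigroup_zero])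
    (fun s _ => by
      obtain ⟨hm, he⟩ := hL.semigroup_mem s.toNNReal f
      have := hdiss ⟨_, hm⟩ (by rw [X.meanOp_semigroup, hf])
      rw [he] at this
      linarith) t ⟨t.2, le_rfl⟩
  rw [gronwallBound_ε0, sub_zero] at h
  have hut : u t = X.semigroup t f := by simp [hu]
  rw [hut] at h
  refine le_of_sq_le_sq (h.trans_eq ?_) (by positivity)
  rw [mul_pow, ← Real.exp_nat_mul, mul_comm]
  push_cast
  ring_nf

/-- Decay on all mean-zero functions, by density of the domain. -/
theorem norm_semigroup_le (hc : X.StronglyContinuous) (hL : X.IsGenerator L)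
    (hdense : Dense (L.domain : Set (Lp ℝ 2 π)))
    (hdiss : ∀ f : L.domain, meanOp π f = 0 →
      inner ℝ (f : Lp ℝ 2 π) (L f) ≤ lam * ‖(f : Lp ℝ 2 π)‖ ^ 2)
    (f : Lp ℝ 2 π) (hf : meanOp π f = 0) (t : ℝ≥0) :
    ‖X.semigroup t f‖ ≤ Real.exp (lam * t) * ‖f‖ := by
  have key : ∀ g : Lp ℝ 2 π,
      ‖X.semigroup t (g - meanOp π g)‖ ≤ Real.exp (lam * t) * ‖g - meanOp π g‖ := by
    intro g
    refine hdense.induction (P := fun g => ‖X.semigroup t (g - meanOp π g)‖ ≤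
      Real.exp (lam * t) * ‖g - meanOp π g‖) ?_ ?_ g
    · intro g hg
      exact norm_semigroup_le_of_mem_domain hc hL hdiss
        ⟨g - meanOp π g, L.domain.sub_mem hg (hL.meanOp_mem g).1⟩
        (by rw [map_sub, meanOp_meanOp, sub_self]) t
    · exact isClosed_le (by fun_prop) (by fun_prop)
  simpa [hf] using key f

end Decay

/-! ### Real and imaginary parts in complex `L²` -/

section Complexification

variable {K : Type*} [MeasurableSpace K] {π : Measure K}

theorem reL2_ofRealL2 (u : Lp ℝ 2 π) : reL2 π (ofRealL2 π u) = u := by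
  apply Lp.ext
  filter_upwards [Complex.reCLM.coeFn_compLpL (p := 2) (μ := π) (ofRealL2 π u),
    Complex.ofRealCLM.coeFn_compLpL (p := 2) (μ := π) u] with x h1 h2
  exact h1.trans ((congrArg Complex.re h2).trans (Complex.ofReal_re _))

theorem imL2_ofRealL2 (u : Lp ℝ 2 π) : imL2 π (ofRealL2 π u) = 0 := by
  apply Lp.ext
  filter_upwards [Complex.imCLM.coeFn_compLpL (p := 2) (μ := π) (ofRealL2 π u),
    Complex.ofRealCLM.coeFn_compLpL (p := 2) (μ := π) u, Lp.coeFn_zero ℝ 2 π] with x h1 h2 h3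
  rw [h3]
  exact h1.trans ((congrArg Complex.im h2).trans (Complex.ofReal_im _))

theorem ofRealL2_reL2_add (f : Lp ℂ 2 π) :
    ofRealL2 π (reL2 π f) + Complex.I • ofRealL2 π (imL2 π f) = f := by
  apply Lp.ext
  filter_upwards [Complex.imCLM.coeFn_compLpL (p := 2) (μ := π) f,
    Complex.reCLM.coeFn_compLpL (p := 2) (μ := π) f,
    Complex.ofRealCLM.coeFn_compLpL (p := 2) (μ := π) (reL2 π f),
    Complex.ofRealCLM.coeFn_compLpL (p := 2) (μ := π) (imL2 π f),
    Lp.coeFn_add (ofRealL2 π (reL2 π f)) (Complex.I • ofRealL2 π (imL2 π f)),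
    Lp.coeFn_smul Complex.I (ofRealL2 π (imL2 π f))] with x h1 h2 h3 h4 h5 h6
  rw [h5, Pi.add_apply, h6, Pi.smul_apply]
  refine (congrArg₂ (fun a b : ℂ => a + Complex.I • b) (h3.trans (congrArg _ h2))
    (h4.trans (congrArg _ h1))).trans ?_
  rw [smul_eq_mul, mul_comm]
  exact Complex.re_add_im _

theorem reL2_add_I_smul (u v : Lp ℝ 2 π) :
    reL2 π (ofRealL2 π u + Complex.I • ofRealL2 π v) = u := by
  rw [map_add, reL2_smul, reL2_ofRealL2, reL2_ofRealL2, imL2_ofRealL2]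
  simp

theorem imL2_add_I_smul (u v : Lp ℝ 2 π) :
    imL2 π (ofRealL2 π u + Complex.I • ofRealL2 π v) = v := by
  rw [map_add, imL2_smul, imL2_ofRealL2, imL2_ofRealL2, reL2_ofRealL2]
  simp

theorem ext_reL2_imL2 {f g : Lp ℂ 2 π} (h1 : reL2 π f = reL2 π g) (h2 : imL2 π f = imL2 π g) :
    f = g := by
  rw [← ofRealL2_reL2_add f, h1, h2, ofRealL2_reL2_add]

theorem inner_ofRealL2 (u v : Lp ℝ 2 π) :
    inner ℂ (ofRealL2 π u) (ofRealL2 π v) = ((inner ℝ u v : ℝ) : ℂ) := by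
  rw [L2.inner_def, L2.inner_def, ← integral_complex_ofReal]
  refine integral_congr_ae ?_
  filter_upwards [Complex.ofRealCLM.coeFn_compLpL (p := 2) (μ := π) u,
    Complex.ofRealCLM.coeFn_compLpL (p := 2) (μ := π) v] with x h1 h2
  refine (congrArg₂ (fun a b : ℂ => inner ℂ a b) h1 h2).trans ?_
  simp

/-- The complex inner product in terms of real and imaginary parts. -/
theorem inner_eq_reL2_imL2 (f g : Lp ℂ 2 π) :
    inner ℂ f g =
      ((inner ℝ (reL2 π f) (reL2 π g) + inner ℝ (imL2 π f) (imL2 π g) : ℝ) : ℂ) +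
      ((inner ℝ (reL2 π f) (imL2 π g) - inner ℝ (imL2 π f) (reL2 π g) : ℝ) : ℂ) * Complex.I := by
  conv_lhs => rw [← ofRealL2_reL2_add f, ← ofRealL2_reL2_add g]
  simp only [inner_add_left, inner_add_right, inner_smul_left, inner_smul_right, inner_ofRealL2,
    Complex.conj_I]
  push_cast
  linear_combination
    (-((inner ℝ (imL2 π f) (imL2 π g) : ℝ) : ℂ)) * Complex.I_sq

theorem re_inner_eq (f g : Lp ℂ 2 π) :
    (inner ℂ f g).re = inner ℝ (reL2 π f) (reL2 π g) + inner ℝ (imL2 π f) (imL2 π g) := by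
  rw [inner_eq_reL2_imL2]
  simp

theorem norm_sq_eq_reL2_imL2 (f : Lp ℂ 2 π) : ‖f‖ ^ 2 = ‖reL2 π f‖ ^ 2 + ‖imL2 π f‖ ^ 2 := by
  have h := re_inner_eq f f
  rw [real_inner_self_eq_norm_sq, real_inner_self_eq_norm_sq, inner_self_eq_norm_sq_to_K] at h
  rw [← h]
  norm_cast

/-- The extension to complex `L²(π)` of a bounded operator in real `L²(π)`. -/
def complexifyCLM (T : Lp ℝ 2 π →L[ℝ] Lp ℝ 2 π) : Lp ℂ 2 π →L[ℂ] Lp ℂ 2 π where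
  toFun f := ofRealL2 π (T (reL2 π f)) + Complex.I • ofRealL2 π (T (imL2 π f))
  map_add' f g := by
    simp only [map_add, smul_add]
    abel
  map_smul' c f := by
    refine ext_reL2_imL2 ?_ ?_
    · rw [RingHom.id_apply, reL2_add_I_smul, reL2_smul c (_ + _), reL2_add_I_smul,
        imL2_add_I_smul, reL2_smul, map_sub, map_smul, map_smul]
    · rw [RingHom.id_apply, imL2_add_I_smul, imL2_smul c (_ + _), reL2_add_I_smul,
        imL2_add_I_smul, imL2_smul, map_add, map_smul, map_smul]
  cont := by fun_prop

theorem reL2_complexifyCLM (T : Lp ℝ 2 π →L[ℝ] Lp ℝ 2 π) (f : Lp ℂ 2 π) :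
    reL2 π (complexifyCLM T f) = T (reL2 π f) :=
  reL2_add_I_smul _ _

theorem imL2_complexifyCLM (T : Lp ℝ 2 π →L[ℝ] Lp ℝ 2 π) (f : Lp ℂ 2 π) :
    imL2 π (complexifyCLM T f) = T (imL2 π f) :=
  imL2_add_I_smul _ _

theorem norm_complexifyCLM_apply_le {T : Lp ℝ 2 π →L[ℝ] Lp ℝ 2 π} {f : Lp ℂ 2 π} {c : ℝ}
    (hc : 0 ≤ c) (h1 : ‖T (reL2 π f)‖ ≤ c * ‖reL2 π f‖)
    (h2 : ‖T (imL2 π f)‖ ≤ c * ‖imL2 π f‖) : ‖complexifyCLM T f‖ ≤ c * ‖f‖ := by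
  refine le_of_sq_le_sq ?_ (by positivity)
  rw [mul_pow, norm_sq_eq_reL2_imL2, norm_sq_eq_reL2_imL2 f, reL2_complexifyCLM,
    imL2_complexifyCLM, mul_add, ← mul_pow, ← mul_pow]
  gcongr

/-! ### The complexification of an unbounded operator -/

variable {B : Lp ℝ 2 π →ₗ.[ℝ] Lp ℝ 2 π}

theorem reL2_complexify (f : (complexify B).domain) :
    reL2 π (complexify B f) = B ⟨reL2 π f, f.2.1⟩ :=
  reL2_add_I_smul _ _

theorem imL2_complexify (f : (complexify B).domain) :
    imL2 π (complexify B f) = B ⟨imL2 π f, f.2.2⟩ :=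
  imL2_add_I_smul _ _

theorem exists_complexify_eq {f : Lp ℂ 2 π} {u v : B.domain} (hu : reL2 π f = u)
    (hv : imL2 π f = v) : ∃ hf : f ∈ (complexify B).domain,
      complexify B ⟨f, hf⟩ = ofRealL2 π (B u) + Complex.I • ofRealL2 π (B v) := by
  obtain ⟨u, hud⟩ := u
  obtain ⟨v, hvd⟩ := v
  dsimp only at hu hv
  subst hu hv
  exact ⟨⟨hud, hvd⟩, rfl⟩

theorem inner_complexify_comm
    (hB : ∀ f g : B.domain, inner ℝ (f : Lp ℝ 2 π) (B g) = inner ℝ (B f) (g : Lp ℝ 2 π))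
    (f g : (complexify B).domain) :
    inner ℂ (f : Lp ℂ 2 π) (complexify B g) = inner ℂ (complexify B f) (g : Lp ℂ 2 π) := by
  rw [inner_eq_reL2_imL2, inner_eq_reL2_imL2, reL2_complexify, reL2_complexify, imL2_complexify,
    imL2_complexify]
  have h1 := hB ⟨reL2 π f, f.2.1⟩ ⟨reL2 π g, g.2.1⟩
  have h2 := hB ⟨reL2 π f, f.2.1⟩ ⟨imL2 π g, g.2.2⟩
  have h3 := hB ⟨imL2 π f, f.2.2⟩ ⟨reL2 π g, g.2.1⟩
  have h4 := hB ⟨imL2 π f, f.2.2⟩ ⟨imL2 π g, g.2.2⟩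
  dsimp only at h1 h2 h3 h4
  rw [h1, h2, h3, h4]

end Complexification

/-! ### The spectral gap inequality for self-adjoint operators -/

section HilbertSpace

variable {E : Type*} [NormedAddCommGroup E] [InnerProductSpace ℂ E] [CompleteSpace E]

/-- If the spectrum of the self-adjoint operator `R` lies in `[0, a] ∪ {1}`, then
`R ^ 2 ≤ a R` on the orthogonal complement of the fixed vectors of `R`. -/
theorem norm_sq_le_of_spectrum_subset {R : E →L[ℂ] E} (hR : IsSelfAdjoint R) {a : ℝ}
    (hspec : ∀ x ∈ spectrum ℝ R, x = 1 ∨ (0 ≤ x ∧ x ≤ a)) {w : E}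
    (hw : w ∈ ((1 - R).ker)ᗮ) : ‖R w‖ ^ 2 ≤ a * (inner ℂ (R w) w).re := by
  set D : E →L[ℂ] E := 1 - R with hD
  have hDs : IsSelfAdjoint D := (IsSelfAdjoint.one _).sub hR
  set Q : E →L[ℂ] E := R * (algebraMap ℝ (E →L[ℂ] E) a - R) with hQ
  -- the polynomial is nonnegative on the spectrum: its factor `(1 - x) ^ 2` kills the point `1`
  have hnonneg : 0 ≤ Q * D ^ 2 := by
    have h1 : cfc (Polynomial.eval · (Polynomial.X * (Polynomial.C a - Polynomial.X) *
        (1 - Polynomial.X) ^ 2) : ℝ → ℝ) R = Q * D ^ 2 := by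
      rw [cfc_polynomial _ R hR]
      simp [hQ, hD]
    rw [← h1]
    refine cfc_nonneg fun x hx => ?_
    simp only [Polynomial.eval_mul, Polynomial.eval_sub, Polynomial.eval_X, Polynomial.eval_C,
      Polynomial.eval_pow, Polynomial.eval_one]
    rcases hspec x hx with rfl | ⟨h0, ha⟩
    · simp
    · exact mul_nonneg (mul_nonneg h0 (sub_nonneg.2 ha)) (sq_nonneg _)
  have hcomm : Commute Q D := by
    have hRD : Commute R D := (Commute.one_right R).sub_right (Commute.refl R)
    exact hRD.mul_left ((Algebra.commute_algebraMap_left a D).sub_left hRD)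
  have hrange : ∀ v : E, 0 ≤ (inner ℂ (Q (D v)) (D v)).re := by
    intro v
    have h := ((ContinuousLinearMap.nonneg_iff_isPositive _).1 hnonneg).inner_nonneg_left v
    have h2 : inner ℂ ((Q * D ^ 2) v) v = inner ℂ (Q (D v)) (D v) := by
      have : Q * D ^ 2 = D * (Q * D) := by rw [pow_two, ← mul_assoc D Q D, ← hcomm.eq, mul_assoc Q]
      rw [this, mul_apply_eq_comp, mul_apply_eq_comp]
      exact hDs.isSymmetric _ _
    rw [h2] at h
    exact (Complex.le_def.1 h).1
  have hcl : w ∈ closure (Set.range D) := by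
    have h1 : (D.ker)ᗮ = D.range.topologicalClosure := by
      have h2 := D.orthogonal_range
      rw [hDs.adjoint_eq] at h2
      rw [← h2, Submodule.orthogonal_orthogonal_eq_closure]
    rw [h1] at hw
    exact hw
  have hQw : 0 ≤ (inner ℂ (Q w) w).re := by
    refine closure_minimal ?_ (isClosed_le continuous_const (by fun_prop)) hcl
      (t := {w | (0 : ℝ) ≤ (inner ℂ (Q w) w).re})
    rintro _ ⟨v, rfl⟩
    exact hrange v
  have hexp : inner ℂ (Q w) w = a * inner ℂ (R w) w - inner ℂ (R w) (R w) := by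
    rw [hQ, mul_apply_eq_comp]
    have h1 : inner ℂ (R ((algebraMap ℝ (E →L[ℂ] E) a - R) w)) w =
        inner ℂ ((algebraMap ℝ (E →L[ℂ] E) a - R) w) (R w) := hR.isSymmetric _ _
    have h2 : inner ℂ (R w) w = inner ℂ w (R w) := hR.isSymmetric _ _
    have h3 : (algebraMap ℝ (E →L[ℂ] E) a) w = (a : ℂ) • w := by
      simp [Algebra.algebraMap_eq_smul_one]
    rw [h1, sub_apply, inner_sub_left, h3, inner_smul_left, h2,
      Complex.conj_ofReal]
  rw [hexp, inner_self_eq_norm_sq_to_K] at hQw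
  have h4 : ((a : ℂ) * inner ℂ (R w) w - ((‖R w‖ : ℂ)) ^ 2).re
      = a * (inner ℂ (R w) w).re - ‖R w‖ ^ 2 := by
    rw [Complex.sub_re, Complex.re_ofReal_mul, ← Complex.ofReal_pow, Complex.ofReal_re]
  have h5 : 0 ≤ a * (inner ℂ (R w) w).re - ‖R w‖ ^ 2 := h4 ▸ hQw
  linarith

/-- A symmetric everywhere defined injective operator has dense range. -/
theorem dense_range_of_injective {R : E →L[ℂ] E} (hR : IsSelfAdjoint R)
    (hinj : Function.Injective R) : Dense (Set.range R) := by
  have h : (R.range)ᗮ = ⊥ := by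
    rw [R.orthogonal_range, hR.adjoint_eq]
    exact LinearMap.ker_eq_bot.2 hinj
  exact Submodule.dense_iff_topologicalClosure_eq_top.2
    (Submodule.topologicalClosure_eq_top_iff.2 h)

end HilbertSpace

/-! ### Resolvents of a symmetric operator -/

section Resolvent

variable {H : Type*} [NormedAddCommGroup H] [InnerProductSpace ℂ H] {T : H →ₗ.[ℂ] H}

/-- `R` is the resolvent `(z - T)⁻¹`. -/
def IsResolvent (T : H →ₗ.[ℂ] H) (z : ℂ) (R : H →L[ℂ] H) : Prop :=
  (∀ g : H, ∃ f : T.domain, (f : H) = R g ∧ z • (f : H) - T f = g) ∧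
    ∀ f : T.domain, R (z • (f : H) - T f) = f

theorem notMem_opSpectrum_iff {z : ℂ} : z ∉ opSpectrum T ↔ ∃ R, IsResolvent T z R :=
  not_not

theorem IsResolvent.injective {z : ℂ} {R : H →L[ℂ] H} (hR : IsResolvent T z R) :
    Function.Injective R := by
  intro g h hgh
  obtain ⟨f, hf, hf'⟩ := hR.1 g
  obtain ⟨k, hk, hk'⟩ := hR.1 h
  have : f = k := Subtype.ext (by rw [hf, hk, hgh])
  rw [← hf', ← hk', this]

/-- The resolvent of a symmetric operator at a real point is self-adjoint. -/
theorem IsResolvent.isSelfAdjoint [CompleteSpace H]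
    (hT : ∀ f g : T.domain, inner ℂ (f : H) (T g) = inner ℂ (T f) (g : H))
    {x : ℝ} {R : H →L[ℂ] H} (hR : IsResolvent T x R) : IsSelfAdjoint R := by
  rw [ContinuousLinearMap.isSelfAdjoint_iff_isSymmetric]
  intro g h
  obtain ⟨f, hf, hf'⟩ := hR.1 g
  obtain ⟨k, hk, hk'⟩ := hR.1 h
  change inner ℂ (R g) h = inner ℂ g (R h)
  rw [← hf, ← hk]
  conv_lhs => rw [← hk']
  conv_rhs => rw [← hf']
  rw [inner_sub_right, inner_sub_left, inner_smul_left, inner_smul_right, hT, Complex.conj_ofReal]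

/-- Spectral mapping for the resolvent at `1`: if `1 - x⁻¹` is a regular point of `T`, then `x` is
a regular point of `(1 - T)⁻¹`, with inverse `x⁻¹ + x⁻² (1 - x⁻¹ - T)⁻¹`. -/
theorem IsResolvent.isUnit_sub {R R' : H →L[ℂ] H} (hR : IsResolvent T 1 R) {x : ℂ} (hx : x ≠ 0)
    (hR' : IsResolvent T (1 - x⁻¹) R') : IsUnit (algebraMap ℂ (H →L[ℂ] H) x - R) := by
  set V : H →L[ℂ] H := x⁻¹ • (1 + x⁻¹ • R') with hV
  have hmul : ∀ g, (algebraMap ℂ (H →L[ℂ] H) x - R) (V g) = g := by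
    intro g
    obtain ⟨f, hf, hg⟩ := hR'.1 g
    have h1 : R g = f - x⁻¹ • R f := by
      have : g = ((1 : ℂ) • (f : H) - T f) - x⁻¹ • (f : H) := by
        rw [← hg, sub_smul]
        abel
      rw [this, map_sub, hR.2, map_smul]
    have h2 : V g = x⁻¹ • (g + x⁻¹ • (f : H)) := by
      rw [hf]
      rfl
    rw [h2, Algebra.algebraMap_eq_smul_one]
    simp only [sub_apply, smul_apply, one_apply_eq_self, map_smul, map_add, h1]
    have h3 : x • g - ((f : H) - x⁻¹ • R f) + x⁻¹ • (x • (f : H) - R f) = x • g := by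
      rw [smul_sub, inv_smul_smul₀ hx]
      abel
    rw [h3, inv_smul_smul₀ hx]
  have hmul' : ∀ g, V ((algebraMap ℂ (H →L[ℂ] H) x - R) g) = g := by
    intro g
    obtain ⟨k, hk, hg⟩ := hR.1 g
    have h1 : R' (g - x⁻¹ • (k : H)) = k := by
      have : g - x⁻¹ • (k : H) = (1 - x⁻¹) • (k : H) - T k := by
        rw [← hg, sub_smul]
        abel
      rw [this, hR'.2]
    have h2 : x⁻¹ • ((algebraMap ℂ (H →L[ℂ] H) x - R) g) = g - x⁻¹ • (k : H) := by
      rw [Algebra.algebraMap_eq_smul_one, sub_apply, smul_apply, smul_sub, one_apply_eq_self,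
        inv_smul_smul₀ hx, hk]
    have h3 : ∀ v, V v = x⁻¹ • v + x⁻¹ • R' (x⁻¹ • v) := fun v => by
      rw [map_smul, ← smul_add]
      rfl
    rw [h3, h2, h1, sub_add_cancel]
  exact ⟨⟨_, V, ContinuousLinearMap.ext hmul, ContinuousLinearMap.ext hmul'⟩, rfl⟩

end Resolvent

/-! ### The Poincaré inequality of the reversible process -/

section Poincare

theorem exists_resolvent_of_gap {K : Type*} [MeasurableSpace K] {π : Measure K}
    {L : Lp ℝ 2 π →ₗ.[ℝ] Lp ℝ 2 π} {lam : ℝ}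
    (hgap : specL2 L \ {0} ⊆ {z : ℂ | z.im = 0 ∧ z.re ≤ lam}) {x : ℝ} (hx0 : x ≠ 0)
    (hx : lam < x) : ∃ R, IsResolvent (complexify L) (x : ℂ) R := by
  rw [← notMem_opSpectrum_iff]
  intro hmem
  exact hx.not_ge (hgap ⟨hmem, by simpa using hx0⟩).2

variable {K : Type*} [MeasurableSpace K] {π : Measure K} [IsProbabilityMeasure π]
  {X : MarkovProcess K π} {L : Lp ℝ 2 π →ₗ.[ℝ] Lp ℝ 2 π} {lam : ℝ}

/-- The domain of the generator of a reversible process is dense: it contains the real parts of the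
range of the self-adjoint injective operator `(1 - L)⁻¹`. -/
theorem dense_domain (hL : X.IsGenerator L) (hr : X.Reversible) {R : Lp ℂ 2 π →L[ℂ] Lp ℂ 2 π}
    (hR : IsResolvent (complexify L) ((1 : ℝ) : ℂ) R) : Dense (L.domain : Set (Lp ℝ 2 π)) := by
  have hRs := hR.isSelfAdjoint (inner_complexify_comm (hL.symmetric hr))
  have hsurj : Function.Surjective (reL2 π) := fun u => ⟨_, reL2_ofRealL2 u⟩
  refine (hsurj.denseRange.comp (dense_range_of_injective hRs hR.injective)
    (reL2 π).continuous).mono ?_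
  rintro _ ⟨g, rfl⟩
  obtain ⟨f, hf, -⟩ := hR.1 g
  rw [Function.comp_apply, ← hf]
  exact f.2.1

/-- A fixed vector of `(1 - L)⁻¹` is annihilated by `L`, hence constant by ergodicity. -/
theorem reL2_imL2_of_fixed (hc : X.StronglyContinuous) (he : X.Ergodic)
    (hL : X.IsGenerator L) {R : Lp ℂ 2 π →L[ℂ] Lp ℂ 2 π}
    (hR : IsResolvent (complexify L) 1 R) {k : Lp ℂ 2 π} (hk : R k = k) :
    meanOp π (reL2 π k) = reL2 π k ∧ meanOp π (imL2 π k) = imL2 π k := by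
  have hconst : ∀ f : L.domain, L f = 0 → meanOp π f = f := by
    intro f hf
    obtain ⟨c, hfc⟩ := he f fun t => hL.semigroup_eq_self hc f hf t
    have h1 : (f : Lp ℝ 2 π) = c • Lp.const 2 π (1 : ℝ) := by
      apply Lp.ext
      filter_upwards [hfc, Lp.coeFn_smul c (Lp.const 2 π (1 : ℝ)),
        Lp.coeFn_const (p := 2) (μ := π) (1 : ℝ)] with x h1 h2 h3
      rw [h1, h2, Pi.smul_apply, h3]
      simp
    rw [h1, map_smul, meanOp_const_one]
  obtain ⟨f, hf, hg⟩ := hR.1 k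
  rw [hk] at hf
  have h0 : complexify L f = 0 := by
    rw [hf, one_smul, sub_eq_self] at hg
    exact hg
  have h1 := reL2_complexify f
  have h2 := imL2_complexify f
  rw [h0, map_zero] at h1 h2
  rw [← hf]
  exact ⟨hconst _ h1.symm, hconst _ h2.symm⟩

/-- The spectral gap gives the Poincaré inequality `⟪f, L f⟫ ≤ lam ‖f‖²` on mean-zero functions. -/
theorem inner_generator_le (hc : X.StronglyContinuous) (he : X.Ergodic) (hr : X.Reversible)
    (hL : X.IsGenerator L) (hlam : lam < 0)
    (hgap : specL2 L \ {0} ⊆ {z : ℂ | z.im = 0 ∧ z.re ≤ lam})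
    (f : L.domain) (hf : meanOp π f = 0) :
    inner ℝ (f : Lp ℝ 2 π) (L f) ≤ lam * ‖(f : Lp ℝ 2 π)‖ ^ 2 := by
  obtain ⟨R, hR⟩ := exists_resolvent_of_gap hgap (x := 1) one_ne_zero (by linarith)
  have hRs := hR.isSelfAdjoint (inner_complexify_comm (hL.symmetric hr))
  rw [Complex.ofReal_one] at hR
  have hpos : 0 < 1 - lam := by linarith
  have hspec : ∀ x ∈ spectrum ℝ R, x = 1 ∨ (0 ≤ x ∧ x ≤ (1 - lam)⁻¹) := by
    intro x hx
    by_contra! hcon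
    obtain ⟨hx1, hx2⟩ := hcon
    have hx0 : x ≠ 0 := by
      rintro rfl
      exact (hx2 le_rfl).not_ge (by positivity)
    have hlt : lam < 1 - x⁻¹ := by
      rcases lt_or_gt_of_ne hx0 with hneg | hxpos
      · have := inv_lt_zero.2 hneg
        linarith
      · have := (inv_lt_comm₀ hpos hxpos).1 (hx2 hxpos.le)
        linarith
    have hne : 1 - x⁻¹ ≠ 0 := by
      intro h
      exact hx1 (inv_eq_one.1 (sub_eq_zero.1 h).symm)
    obtain ⟨R', hR'⟩ := exists_resolvent_of_gap hgap hne hlt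
    rw [Complex.ofReal_sub, Complex.ofReal_one, Complex.ofReal_inv] at hR'
    exact hx (hR.isUnit_sub (Complex.ofReal_ne_zero.2 hx0) hR')
  -- the function `w = f - L f` has mean zero, and `f = R w`
  set w : Lp ℂ 2 π := ofRealL2 π ((f : Lp ℝ 2 π) - L f) with hw
  have hRw : R w = ofRealL2 π f := by
    obtain ⟨hmem, heq⟩ := exists_complexify_eq (B := L) (f := ofRealL2 π (f : Lp ℝ 2 π)) (u := f)
      (v := 0) (reL2_ofRealL2 _) (imL2_ofRealL2 _)
    rw [L.map_zero, map_zero, smul_zero, add_zero] at heq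
    have h := hR.2 ⟨_, hmem⟩
    rwa [heq, one_smul, ← map_sub] at h
  have hint : ∫ x, ((f : Lp ℝ 2 π) - L f : Lp ℝ 2 π) x ∂π = 0 := by
    have h1 : meanOp π ((f : Lp ℝ 2 π) - L f) = 0 := by
      rw [map_sub, hf, hL.meanOp_apply_eq_zero, sub_zero]
    rw [meanOp_apply] at h1
    have h2 := congrArg (fun g : Lp ℝ 2 π => inner ℝ (Lp.const 2 π (1 : ℝ)) g) h1
    simpa only [inner_smul_right, inner_const_one, integral_const_one, mul_one,
      inner_zero_right] using h2
  have hperp : w ∈ ((1 - R).ker)ᗮ := by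
    intro k hk
    have hk' : R k = k := by
      have : k - R k = 0 := hk
      exact (sub_eq_zero.1 this).symm
    obtain ⟨h1, h2⟩ := reL2_imL2_of_fixed hc he hL hR hk'
    have hz : ∀ u : Lp ℝ 2 π, meanOp π u = u → inner ℝ u ((f : Lp ℝ 2 π) - L f) = 0 := by
      intro u hu
      rw [← hu, real_inner_comm, inner_meanOp_right, hint, zero_mul]
    rw [inner_eq_reL2_imL2, hw, reL2_ofRealL2, imL2_ofRealL2, hz _ h1, hz _ h2]
    simp
  have hkey := norm_sq_le_of_spectrum_subset hRs hspec hperp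
  rw [hRw, re_inner_eq, norm_sq_eq_reL2_imL2, hw, reL2_ofRealL2, reL2_ofRealL2, imL2_ofRealL2,
    imL2_ofRealL2, inner_zero_left, norm_zero, inner_sub_right, real_inner_self_eq_norm_sq,
    inv_mul_eq_div, le_div_iff₀ hpos] at hkey
  linarith

end Poincare

/-! ### Laplace transforms of operator families -/

section Laplace

variable {E : Type*} [NormedAddCommGroup E] [NormedSpace ℂ E]
  {V : ℝ≥0 → E →L[ℂ] E} {C ω : ℝ} {z : ℂ}

theorem norm_laplace_integrand_le (hV : ∀ t g, ‖V t g‖ ≤ C * Real.exp (ω * t) * ‖g‖) (g : E)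
    {t : ℝ} (ht : 0 ≤ t) : ‖Complex.exp (-z * t) • V t.toNNReal g‖ ≤
      C * ‖g‖ * Real.exp (-(z.re - ω) * t) := by
  rw [norm_smul, Complex.norm_exp]
  have h := hV t.toNNReal g
  rw [Real.coe_toNNReal _ ht] at h
  have h2 : (-z * t).re = -z.re * t := by simp
  rw [h2]
  calc Real.exp (-z.re * t) * ‖V t.toNNReal g‖
      ≤ Real.exp (-z.re * t) * (C * Real.exp (ω * t) * ‖g‖) := by gcongr
    _ = C * ‖g‖ * (Real.exp (-z.re * t) * Real.exp (ω * t)) := by ring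
    _ = C * ‖g‖ * Real.exp (-(z.re - ω) * t) := by
      rw [← Real.exp_add]
      ring_nf

theorem continuous_laplace_integrand (hVc : ∀ g, Continuous fun t => V t g) (g : E) :
    Continuous fun t : ℝ => Complex.exp (-z * t) • V t.toNNReal g :=
  Continuous.smul (by fun_prop) ((hVc g).comp continuous_real_toNNReal)

theorem integrableOn_laplace (hVc : ∀ g, Continuous fun t => V t g)
    (hV : ∀ t g, ‖V t g‖ ≤ C * Real.exp (ω * t) * ‖g‖) (hz : ω < z.re) (g : E) :
    IntegrableOn (fun t : ℝ => Complex.exp (-z * t) • V t.toNNReal g) (Set.Ioi 0) := by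
  refine ((exp_neg_integrableOn_Ioi 0 (sub_pos.2 hz)).const_mul (C * ‖g‖)).mono'
    (continuous_laplace_integrand hVc g).aestronglyMeasurable ?_
  filter_upwards [ae_restrict_mem measurableSet_Ioi] with t ht
  exact norm_laplace_integrand_le hV g (le_of_lt ht)

/-- The Laplace transform of a strongly continuous family of operators of exponential type `ω` is
a bounded operator for `ω < Re z`. -/
theorem exists_laplace (hVc : ∀ g, Continuous fun t => V t g)
    (hV : ∀ t g, ‖V t g‖ ≤ C * Real.exp (ω * t) * ‖g‖) (hz : ω < z.re) :
    ∃ F : E →L[ℂ] E, ∀ g,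
      F g = ∫ t in Set.Ioi (0 : ℝ), Complex.exp (-z * t) • V t.toNNReal g := by
  refine ⟨LinearMap.mkContinuous
    { toFun := fun g => ∫ t in Set.Ioi (0 : ℝ), Complex.exp (-z * t) • V t.toNNReal g
      map_add' := fun g h => ?_
      map_smul' := fun c g => ?_ }
    (C * ∫ t in Set.Ioi (0 : ℝ), Real.exp (-(z.re - ω) * t)) fun g => ?_, fun g => rfl⟩
  · rw [← integral_add (integrableOn_laplace hVc hV hz g) (integrableOn_laplace hVc hV hz h)]
    simp only [map_add, smul_add]
  · rw [RingHom.id_apply, ← integral_smul]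
    simp only [map_smul, smul_comm c]
  · refine (norm_integral_le_of_norm_le
      ((exp_neg_integrableOn_Ioi 0 (sub_pos.2 hz)).const_mul (C * ‖g‖)) ?_).trans_eq ?_
    · filter_upwards [ae_restrict_mem measurableSet_Ioi] with t ht
      exact norm_laplace_integrand_le hV g (le_of_lt ht)
    · rw [integral_const_mul]
      ring

/-- The Laplace transform `F` of a family `V` shifted by the semigroup `U`, `U s ∘ V t = V (s + t)`,
satisfies the resolvent equation `(d/dh) U h (F g) = z F g - V 0 g` at `h = 0`: indeed
`U h (F g)` is `exp (z h)` times the integral over `(h, ∞)` that defines `F g`. -/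
theorem tendsto_laplace [CompleteSpace E] {U : ℝ≥0 → E →L[ℂ] E}
    (hUV : ∀ s t g, U s (V t g) = V (s + t) g) (hVc : ∀ g, Continuous fun t => V t g)
    (hV : ∀ t g, ‖V t g‖ ≤ C * Real.exp (ω * t) * ‖g‖) (hz : ω < z.re) {F : E →L[ℂ] E}
    (hF : ∀ g, F g = ∫ t in Set.Ioi (0 : ℝ), Complex.exp (-z * t) • V t.toNNReal g) (g : E) :
    Tendsto (fun t : ℝ≥0 => (t : ℝ)⁻¹ • (U t (F g) - F g)) (𝓝[>] 0) (𝓝 (z • F g - V 0 g)) := by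
  set φ : ℝ → E := fun t => Complex.exp (-z * t) • V t.toNNReal g with hφ
  have hφc : Continuous φ := continuous_laplace_integrand hVc g
  have hφi : IntegrableOn φ (Set.Ioi 0) := integrableOn_laplace hVc hV hz g
  set G : ℝ → E := fun h => Complex.exp (z * h) • (F g - ∫ t in (0 : ℝ)..h, φ t) with hG
  have hG0 : G 0 = F g := by simp [hG]
  have hshift : ∀ h : ℝ≥0, U h (F g) = G h := by
    intro h
    have h1 : U h (F g) = ∫ t in Set.Ioi (0 : ℝ), Complex.exp (z * h) • φ (t + h) := by
      rw [hF, ← ContinuousLinearMap.integral_comp_comm _ hφi]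
      refine setIntegral_congr_fun measurableSet_Ioi fun t (ht : 0 < t) => ?_
      have h2 : (t + h).toNNReal = h + t.toNNReal := by
        rw [Real.toNNReal_add ht.le h.coe_nonneg, Real.toNNReal_coe, add_comm]
      simp only [hφ]
      rw [map_smul, hUV, h2, smul_smul, ← Complex.exp_add]
      push_cast
      ring_nf
    have h3 := (measurePreserving_add_right volume (h : ℝ)).setIntegral_preimage_emb
      (measurableEmbedding_addRight (h : ℝ)) φ (Set.Ioi (h : ℝ))
    rw [Set.preimage_add_const_Ioi, sub_self] at h3
    have h4 := intervalIntegral.integral_Ioi_sub_Ioi hφi h.coe_nonneg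
    rw [h1, integral_smul, h3, hG]
    dsimp only
    rw [hF, ← h4, sub_sub_cancel]
  have hderiv : HasDerivAt G (z • F g - V 0 g) 0 := by
    have h1 : HasDerivAt (fun h : ℝ => Complex.exp (z * h)) z 0 := by
      have := ((Complex.ofRealCLM.hasDerivAt (x := (0 : ℝ))).const_mul z).cexp
      simpa using this
    have h2 : HasDerivAt (fun h : ℝ => F g - ∫ t in (0 : ℝ)..h, φ t) (-φ 0) 0 :=
      (hφc.integral_hasStrictDerivAt 0 0).hasDerivAt.const_sub _
    have h3 := h1.smul h2
    have h4 : φ 0 = V 0 g := by simp [hφ]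
    rw [h4, Complex.ofReal_zero, mul_zero, Complex.exp_zero, one_smul,
      intervalIntegral.integral_same, sub_zero, neg_add_eq_sub] at h3
    exact h3
  have hs := hderiv.hasDerivWithinAt (s := Set.Ioi 0)
  rw [hasDerivWithinAt_iff_tendsto_slope' (by simp)] at hs
  have hcoe : Tendsto (fun t : ℝ≥0 => (t : ℝ)) (𝓝[>] 0) (𝓝[>] 0) := by
    refine tendsto_nhdsWithin_iff.2 ⟨?_, ?_⟩
    · exact (NNReal.continuous_coe.tendsto 0).mono_left nhdsWithin_le_nhds
    · filter_upwards [self_mem_nhdsWithin] with t ht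
      exact NNReal.coe_pos.2 ht
  refine (hs.comp hcoe).congr fun t => ?_
  rw [Function.comp_apply, slope_def_module, hG0, hshift, sub_zero]

end Laplace

/-! ### The resolvent of the perturbed generator -/

section ResolventOfDecay

variable {K : Type*} [MeasurableSpace K] {π : Measure K} [IsProbabilityMeasure π]
  {X : MarkovProcess K π} {L : Lp ℝ 2 π →ₗ.[ℝ] Lp ℝ 2 π} {lam : ℝ} {z : ℂ}

theorem MarkovProcess.IsGenerator.exists_complexify_of_tendsto (hL : X.IsGenerator L)
    {f k : Lp ℂ 2 π}
    (h : Tendsto (fun t : ℝ≥0 => (t : ℝ)⁻¹ • (complexifyCLM (X.semigroup t) f - f)) (𝓝[>] 0)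
      (𝓝 k)) : ∃ hf : f ∈ (complexify L).domain, complexify L ⟨f, hf⟩ = k := by
  obtain ⟨h1, h1'⟩ := hL.exists_of_tendsto (f := reL2 π f) (g := reL2 π k) <| by
    refine (((reL2 π).continuous.tendsto _).comp h).congr fun t => ?_
    rw [Function.comp_apply, map_smul, map_sub, reL2_complexifyCLM]
  obtain ⟨h2, h2'⟩ := hL.exists_of_tendsto (f := imL2 π f) (g := imL2 π k) <| by
    refine (((imL2 π).continuous.tendsto _).comp h).congr fun t => ?_
    rw [Function.comp_apply, map_smul, map_sub, imL2_complexifyCLM]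
  obtain ⟨hf, hf'⟩ := exists_complexify_eq (B := L) (f := f) (u := ⟨_, h1⟩) (v := ⟨_, h2⟩) rfl rfl
  refine ⟨hf, ?_⟩
  rw [hf', h1', h2', ofRealL2_reL2_add]

/-- Dissipativity on mean-zero functions makes `z - L` injective for `z ≠ 0` and `lam < Re z`. -/
theorem eq_zero_of_smul_eq_complexify (hL : X.IsGenerator L)
    (hdiss : ∀ f : L.domain, meanOp π f = 0 →
      inner ℝ (f : Lp ℝ 2 π) (L f) ≤ lam * ‖(f : Lp ℝ 2 π)‖ ^ 2)
    (hz0 : z ≠ 0) (hz : lam < z.re) (f : (complexify L).domain)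
    (hf : z • (f : Lp ℂ 2 π) = complexify L f) : (f : Lp ℂ 2 π) = 0 := by
  have hM : complexifyCLM (meanOp π) f = 0 := by
    have h1 : complexifyCLM (meanOp π) (complexify L f) = 0 := by
      refine ext_reL2_imL2 ?_ ?_
      · rw [reL2_complexifyCLM, reL2_complexify, hL.meanOp_apply_eq_zero, map_zero]
      · rw [imL2_complexifyCLM, imL2_complexify, hL.meanOp_apply_eq_zero, map_zero]
    rw [← hf, map_smul] at h1
    exact (smul_eq_zero.1 h1).resolve_left hz0
  have h1 := hdiss ⟨reL2 π f, f.2.1⟩ (by rw [← reL2_complexifyCLM, hM, map_zero])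
  have h2 := hdiss ⟨imL2 π f, f.2.2⟩ (by rw [← imL2_complexifyCLM, hM, map_zero])
  rw [← reL2_complexify] at h1
  rw [← imL2_complexify] at h2
  have h3 : (inner ℂ (f : Lp ℂ 2 π) (complexify L f)).re = z.re * ‖(f : Lp ℂ 2 π)‖ ^ 2 := by
    rw [← hf, inner_smul_right, inner_self_eq_norm_sq_to_K]
    change (z * (‖(f : Lp ℂ 2 π)‖ : ℂ) ^ 2).re = _
    rw [← Complex.ofReal_pow, Complex.re_mul_ofReal]
  rw [re_inner_eq] at h3
  have h4 := norm_sq_eq_reL2_imL2 (f : Lp ℂ 2 π)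
  dsimp only at h1 h2
  have h5 : (z.re - lam) * ‖(f : Lp ℂ 2 π)‖ ^ 2 ≤ 0 := by
    rw [sub_mul, ← h3, h4]
    linarith
  have h6 : ‖(f : Lp ℂ 2 π)‖ ^ 2 = 0 := by
    have := sq_nonneg ‖(f : Lp ℂ 2 π)‖
    nlinarith
  exact norm_eq_zero.1 (pow_eq_zero_iff two_ne_zero |>.1 h6)

/-- If a Markov semigroup decays like `exp (lam t)` on mean-zero functions and its generator is
dissipative there, then `z - L` is invertible for `z ≠ 0` and `lam < Re z`. The inverse is the
Laplace transform of the semigroup on mean-zero functions, and `z⁻¹` on the constants. -/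
theorem exists_resolvent_of_decay (hc : X.StronglyContinuous) (hL : X.IsGenerator L)
    (hdiss : ∀ f : L.domain, meanOp π f = 0 →
      inner ℝ (f : Lp ℝ 2 π) (L f) ≤ lam * ‖(f : Lp ℝ 2 π)‖ ^ 2)
    (hdecay : ∀ f : Lp ℝ 2 π, meanOp π f = 0 → ∀ t : ℝ≥0,
      ‖X.semigroup t f‖ ≤ Real.exp (lam * t) * ‖f‖)
    (hz0 : z ≠ 0) (hz : lam < z.re) : ∃ R, IsResolvent (complexify L) z R := by
  set M : Lp ℂ 2 π →L[ℂ] Lp ℂ 2 π := complexifyCLM (meanOp π) with hM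
  set U : ℝ≥0 → Lp ℂ 2 π →L[ℂ] Lp ℂ 2 π := fun t => complexifyCLM (X.semigroup t) with hU
  set V : ℝ≥0 → Lp ℂ 2 π →L[ℂ] Lp ℂ 2 π := fun t => (U t).comp (1 - M) with hVdef
  have hUc : ∀ g, Continuous fun t => U t g := fun g =>
    ((ofRealL2 π).continuous.comp (hc (reL2 π g))).add
      (((ofRealL2 π).continuous.comp (hc (imL2 π g))).const_smul Complex.I)
  have hUadd : ∀ s t g, U s (U t g) = U (s + t) g := by
    intro s t g
    refine ext_reL2_imL2 ?_ ?_
    · simp only [hU, reL2_complexifyCLM, X.semigroup_add]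
    · simp only [hU, imL2_complexifyCLM, X.semigroup_add]
  have hU0 : ∀ g, U 0 g = g := by
    intro g
    refine ext_reL2_imL2 ?_ ?_
    · simp only [hU, reL2_complexifyCLM, X.semigroup_zero]
    · simp only [hU, imL2_complexifyCLM, X.semigroup_zero]
  have hVapp : ∀ t g, V t g = U t (g - M g) := fun t g => rfl
  have hVbound : ∀ t g, ‖V t g‖ ≤ ‖1 - M‖ * Real.exp (lam * t) * ‖g‖ := by
    intro t g
    have h1 : ‖U t (g - M g)‖ ≤ Real.exp (lam * t) * ‖g - M g‖ := by
      refine norm_complexifyCLM_apply_le (Real.exp_pos _).le (hdecay _ ?_ t) (hdecay _ ?_ t)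
      · rw [map_sub, hM, reL2_complexifyCLM, map_sub, meanOp_meanOp, sub_self]
      · rw [map_sub, hM, imL2_complexifyCLM, map_sub, meanOp_meanOp, sub_self]
    have h2 : ‖g - M g‖ ≤ ‖1 - M‖ * ‖g‖ := (1 - M).le_opNorm g
    calc ‖V t g‖ ≤ Real.exp (lam * t) * ‖g - M g‖ := h1
      _ ≤ Real.exp (lam * t) * (‖1 - M‖ * ‖g‖) := by gcongr
      _ = ‖1 - M‖ * Real.exp (lam * t) * ‖g‖ := by ring
  have hVc : ∀ g, Continuous fun t => V t g := fun g => hUc (g - M g)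
  obtain ⟨F, hF⟩ := exists_laplace hVc hVbound hz
  have hright : ∀ g : Lp ℂ 2 π, ∃ f : (complexify L).domain,
      (f : Lp ℂ 2 π) = (F + z⁻¹ • M) g ∧ z • (f : Lp ℂ 2 π) - complexify L f = g := by
    intro g
    have h := tendsto_laplace (U := U) (V := V) (fun s t g => hUadd s t _) hVc hVbound hz hF g
    rw [hVapp, hU0] at h
    obtain ⟨hf, hf'⟩ := hL.exists_complexify_of_tendsto h
    obtain ⟨h1, h1'⟩ := hL.meanOp_mem (reL2 π g)
    obtain ⟨h2, h2'⟩ := hL.meanOp_mem (imL2 π g)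
    obtain ⟨hm, hm'⟩ := exists_complexify_eq (B := L) (f := M g) (u := ⟨_, h1⟩) (v := ⟨_, h2⟩)
      (reL2_complexifyCLM _ _) (imL2_complexifyCLM _ _)
    rw [h1', h2', map_zero, smul_zero, add_zero] at hm'
    refine ⟨⟨F g, hf⟩ + z⁻¹ • ⟨M g, hm⟩, rfl, ?_⟩
    rw [LinearPMap.map_add, LinearPMap.map_smul, hf', hm', smul_zero, add_zero]
    change z • (F g + z⁻¹ • M g) - _ = g
    rw [smul_add, smul_inv_smul₀ hz0]
    abel
  refine ⟨F + z⁻¹ • M, hright, fun f => ?_⟩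
  obtain ⟨k, hk, hk'⟩ := hright (z • (f : Lp ℂ 2 π) - complexify L f)
  rw [← hk]
  have h0 := eq_zero_of_smul_eq_complexify hL hdiss hz0 hz (k - f) (by
    rw [LinearPMap.map_sub]
    change z • ((k : Lp ℂ 2 π) - f) = _
    rw [smul_sub, sub_eq_sub_iff_sub_eq_sub]
    exact hk')
  exact sub_eq_zero.1 h0

end ResolventOfDecay

/-! ### Comparison of the spectral gaps -/

section Perturbation

variable {K : Type*} [MeasurableSpace K] {π : Measure K} [IsProbabilityMeasure π]
  {L₀ S A : Lp ℝ 2 π →ₗ.[ℝ] Lp ℝ 2 π} {X₀ X : MarkovProcess K π} {lam : ℝ}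

/-- Adding a nonpositive and an antisymmetric operator does not increase the quadratic form. -/
theorem inner_add_add_le {H : Type*} [NormedAddCommGroup H] [InnerProductSpace ℝ H]
    {B S A : H →ₗ.[ℝ] H} (hSneg : ∀ f : S.domain, inner ℝ (f : H) (S f) ≤ 0)
    (hAanti : ∀ f g : A.domain, inner ℝ (f : H) (A g) = -inner ℝ (A f) (g : H))
    (f : (B + S + A).domain) :
    inner ℝ (f : H) ((B + S + A) f) ≤ inner ℝ (f : H) (B ⟨f, f.2.1.1⟩) := by
  have hS := hSneg ⟨f, f.2.1.2⟩
  have hA := hAanti ⟨f, f.2.2⟩ ⟨f, f.2.2⟩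
  rw [real_inner_comm (f : H)] at hA
  have hval : (B + S + A) f = B ⟨f, f.2.1.1⟩ + S ⟨f, f.2.1.2⟩ + A ⟨f, f.2.2⟩ := rfl
  rw [hval, inner_add_right, inner_add_right]
  dsimp only at hS hA
  linarith

/-- Decay on mean-zero functions and spectral bound for the perturbed process, at any `lam < 0` that
bounds the nonzero spectrum of the reversible process. -/
theorem decay_and_gap_of_gap (hX₀c : X₀.StronglyContinuous) (hX₀e : X₀.Ergodic)
    (hX₀r : X₀.Reversible) (hL₀ : X₀.IsGenerator L₀) (hlam : lam < 0)
    (hgap : specL2 L₀ \ {0} ⊆ {z : ℂ | z.im = 0 ∧ z.re ≤ lam})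
    (hSdom : L₀.domain ≤ S.domain) (hSneg : ∀ f : S.domain, inner ℝ (f : Lp ℝ 2 π) (S f) ≤ 0)
    (hAdom : (L₀ + S).domain ≤ A.domain)
    (hAanti : ∀ f g : A.domain, inner ℝ (f : Lp ℝ 2 π) (A g) = -inner ℝ (A f) (g : Lp ℝ 2 π))
    (hXc : X.StronglyContinuous) (hL : X.IsGenerator (L₀ + S + A)) :
    (∀ f : Lp ℝ 2 π, meanOp π f = 0 → ∀ t : ℝ≥0,
      ‖X.semigroup t f‖ ≤ Real.exp (lam * t) * ‖f‖) ∧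
    specL2 (L₀ + S + A) \ {0} ⊆ {z : ℂ | z.re ≤ lam} := by
  have hdiss : ∀ f : (L₀ + S + A).domain, meanOp π f = 0 →
      inner ℝ (f : Lp ℝ 2 π) ((L₀ + S + A) f) ≤ lam * ‖(f : Lp ℝ 2 π)‖ ^ 2 := fun f hf =>
    (inner_add_add_le hSneg hAanti f).trans
      (inner_generator_le hX₀c hX₀e hX₀r hL₀ hlam hgap ⟨f, f.2.1.1⟩ hf)
  obtain ⟨R, hR⟩ := exists_resolvent_of_gap hgap (x := 1) one_ne_zero (by linarith)
  have hdense : Dense ((L₀ + S + A).domain : Set (Lp ℝ 2 π)) :=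
    (dense_domain hL₀ hX₀r hR).mono fun f hf =>
      ⟨⟨hf, hSdom hf⟩, hAdom ⟨hf, hSdom hf⟩⟩
  have hdecay := norm_semigroup_le hXc hL hdense hdiss
  refine ⟨hdecay, fun z hz => ?_⟩
  by_contra hlt
  exact hz.1 (exists_resolvent_of_decay hXc hL hdiss hdecay (by simpa using hz.2) (not_le.1 hlt))

end Perturbation

end

end SpectralGap

theorem lemma3p1 {K : Type*} [MeasurableSpace K] (π : Measure K) [IsProbabilityMeasure π]
    -- the reference process, its generator and its spectral gap
    (X₀ : SpectralGap.MarkovProcess K π) (hX₀c : X₀.StronglyContinuous)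
    (hX₀e : X₀.Ergodic) (hX₀r : X₀.Reversible)
    (L₀ : Lp ℝ 2 π →ₗ.[ℝ] Lp ℝ 2 π) (hL₀ : X₀.IsGenerator L₀)
    (lam₀ : ℝ) (hlam₀ : lam₀ < 0)
    (hgap : SpectralGap.specL2 L₀ \ {0} ⊆ {z : ℂ | z.im = 0 ∧ z.re ≤ lam₀})
    -- the reversible perturbation
    (S : Lp ℝ 2 π →ₗ.[ℝ] Lp ℝ 2 π) (hSdom : L₀.domain ≤ S.domain)
    (hSsymm : ∀ f g : S.domain, inner ℝ (f : Lp ℝ 2 π) (S g) = inner ℝ (S f) (g : Lp ℝ 2 π))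
    (hSneg : ∀ f : S.domain, inner ℝ (f : Lp ℝ 2 π) (S f) ≤ 0)
    -- the irreversible perturbation
    (A : Lp ℝ 2 π →ₗ.[ℝ] Lp ℝ 2 π) (hAdom : (L₀ + S).domain ≤ A.domain)
    (hAanti : ∀ f g : A.domain, inner ℝ (f : Lp ℝ 2 π) (A g) = -inner ℝ (A f) (g : Lp ℝ 2 π))
    -- the perturbed process, with the same invariant measure
    (X : SpectralGap.MarkovProcess K π) (hXc : X.StronglyContinuous)
    (hL : X.IsGenerator (L₀ + S + A)) :
    SpectralGap.spectralGap (L₀ + S + A) ≤ SpectralGap.spectralGap L₀ ∧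
    (SpectralGap.specL2 (L₀ + S + A) \ {0} ⊆ {z : ℂ | z.re ≤ lam₀}) ∧
    ∀ (t : NNReal) (f : Lp ℝ 2 π), ∫ x, f x ∂π = 0 →
      ‖X.semigroup t f‖ ≤ Real.exp (lam₀ * t) * ‖f‖ := by
  have hmain := fun (lam : ℝ) (hlam : lam < 0)
      (hgap : SpectralGap.specL2 L₀ \ {0} ⊆ {z : ℂ | z.im = 0 ∧ z.re ≤ lam}) =>
    SpectralGap.decay_and_gap_of_gap hX₀c hX₀e hX₀r hL₀ hlam hgap hSdom hSneg hAdom hAanti hXc hL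
  obtain ⟨hdecay, hspec⟩ := hmain lam₀ hlam₀ hgap
  refine ⟨iSup₂_le fun z hz => ?_, hspec, fun t f hf => hdecay f ?_ t⟩
  · by_contra! hlt
    -- any level between the two gaps is negative, and an admissible spectral bound for `L₀`
    obtain ⟨lam, h1, h2⟩ := EReal.lt_iff_exists_real_btwn.1 hlt
    have h2' : lam < z.re := EReal.coe_lt_coe_iff.1 h2
    have hlam : lam < 0 := (h2'.trans_le (hspec hz)).trans hlam₀
    refine h2'.not_ge ((hmain lam hlam fun w hw => ⟨(hgap hw).1, ?_⟩).2 hz)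
    have h3 : ((w.re : ℝ) : EReal) ≤ SpectralGap.spectralGap L₀ :=
      le_iSup₂ (f := fun (w : ℂ) (_ : w ∈ SpectralGap.specL2 L₀ \ {0}) => ((w.re : ℝ) : EReal)) w hw
    exact (EReal.coe_lt_coe_iff.1 (h3.trans_lt h1)).le
  · rw [SpectralGap.meanOp_apply, hf, zero_smul]
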